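/- Call a function $\phi\colon G\to\mathbb C$ on a group $G$ *positive definite* if $\sum_{i,j}\overline{c_i}\,c_j\,\phi(g_i^{-1}g_j)\geq 0$ for all finite families $g_1,\dots,g_n\in G$ and $c_1,\dots,c_n\in\mathbb C$, and *normalized* if $\phi(1)=1$. Call a function $\psi\colon G\to[0,\infty)$ *conditionally negative definite* if $\psi(g^{-1})=\psi(g)$ for all $g\in G$ and $\sum_{i,j}c_ic_j\,\psi(g_i^{-1}g_j)\leq 0$ for all finite families $g_1,\dots,g_n\in G$ and $c_1,\dots,c_n\in\mathbb R$ with $\sum_i c_i=0$. **Proposition 4.3.** Given $\varepsilon>0$ and $\delta>0$, there exists $C>0$ (depending only on $\varepsilon$ and $\delta$) such that the following holds. Let $A$ be an abelian group, $K_0$ a group, $\alpha\colon K_0\to\operatorname{Aut}(A)$ a homomorphism, $K$ a group, $\pi\colon K\to K_0$ a surjective homomorphism, and $\bar\alpha=\alpha\circ\pi$. Let $U$ be a generating subset of $K$ and $U_0=\pi(U)$. Assume that every normalized positive definite function $\phi$ on $K_0$ with $|\phi(u)|\geq 1-\delta$ for all $u\in U_0$ satisfies $|\phi(k)|\geq\varepsilon$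 for all $k\in K_0$. Then for every $a\in A$, every generating subset $V$ of $L=A\rtimes_{\bar\alpha}K$ containing $a$ and $U$, and every conditionally negative definite function $\psi$ on $L$, $$\sup_{y\in\bar\alpha(K)(a)}\psi(y)\;\leq\;C\,\sup_{v\in V}\psi(v),$$ where the suprema are taken in $[0,\infty]$, and $A$ and $K$ are identified with their canonical copies in $L$. -/

import Mathlib

section

open scoped ComplexOrder ComplexConjugate

/-- A function `φ : G → ℂ` on a (discrete) group is positive definite if for all finite families
`g₁, …, gₙ` in `G` and `c₁, …, cₙ` in `ℂ` the number `∑ᵢⱼ c̄ᵢ cⱼ φ(gᵢ⁻¹ gⱼ)` is real and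
nonnegative (this is what `0 ≤ z` means for a complex number `z`). -/
def IsPosDefFun {G : Type*} [Group G] (φ : G → ℂ) : Prop :=
  ∀ (n : ℕ) (g : Fin n → G) (c : Fin n → ℂ),
    0 ≤ ∑ i, ∑ j, conj (c i) * c j * φ ((g i)⁻¹ * g j)

end

/-- A function `ψ : G → ℝ` on a (discrete) group is conditionally negative definite if it is
nonnegative and symmetric, and if `∑ᵢⱼ cᵢ cⱼ ψ(gᵢ⁻¹ gⱼ) ≤ 0` for all finite families
`g₁, …, gₙ` in `G` and `c₁, …, cₙ` in `ℝ` with `∑ᵢ cᵢ = 0`.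
The frequent normalization `ψ 1 = 0` is not imposed; functions satisfying it (together with
symmetry and the inequality) are automatically nonnegative, so they are all covered. -/
structure IsCondNegDef {G : Type*} [Group G] (ψ : G → ℝ) : Prop where
  nonneg : ∀ g, 0 ≤ ψ g
  symm : ∀ g, ψ g⁻¹ = ψ g
  sum_nonpos : ∀ (n : ℕ) (g : Fin n → G) (c : Fin n → ℝ), ∑ i, c i = 0 →
    ∑ i, ∑ j, c i * c j * ψ ((g i)⁻¹ * g j) ≤ 0

/-- For `β : K →* MulAut A`, the orbit `β(K)(a)` of `a ∈ A`, as a subset of `A ⋊ K`. -/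
def orbitInSemidirect {A K : Type*} [Group A] [Group K] (β : K →* MulAut A) (a : A) :
    Set (A ⋊[β] K) :=
  Set.range fun k : K => SemidirectProduct.inl (β k a)

/-! By Schoenberg, `exp (-t (ψ - ψ 1))` is positive definite on `L`; `t = s / M` makes it close to 1
at `a` and on `U`. Its restriction to `A` is, morally, the Fourier transform of a probability
measure on the dual of `A`, which `K₀` translates through `α`. The Hellinger affinity of this
measure with its translates is an inner product of half-densities, hence positive definite on `K₀`
itself, even though `ψ` lives on `K` (`isRealPosDef_affinity`).

The affinity dominates the values of the function on `K` (`le_affinity_of_inr`), so it is near 1 on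
`U₀`. The hypothesis on `K₀`, applied to a high power of the affinity, upgrades the weak bound `ε`
to affinity at least `49 / 50` everywhere. Two measures of such affinity have close Fourier
coefficients at `a` (`affinity_le_pair`, `lower_bound_of_fidelity`), so `exp (-t (ψ - ψ 1))` stays
above `1 / 8` on the orbit of `a`, which bounds `ψ` there.

No measure is used: finite families with `∑ pᵢ* pᵢ = 1` in the real group algebra replace partitions
of the dual, and the affinity is an infimum over them. -/

/-- Real-valued positive definite functions on a group. -/
def IsRealPosDef {G : Type*} [Group G] (φ : G → ℝ) : Prop :=
  ∀ (n : ℕ) (g : Fin n → G), (Matrix.of fun i j => φ ((g i)⁻¹ * g j)).PosSemidef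

/-! ### Entrywise powers and exponentials of positive semidefinite matrices -/

section Matrices

variable {n : ℕ}

lemma Matrix.posSemidef_real_iff_sum {M : Matrix (Fin n) (Fin n) ℝ} :
    M.PosSemidef ↔ (∀ i j, M j i = M i j) ∧ ∀ c : Fin n → ℝ, 0 ≤ ∑ i, ∑ j, c i * c j * M i j := by
  rw [Matrix.posSemidef_iff_dotProduct_mulVec]
  refine and_congr ?_ (forall_congr' fun c => ?_)
  · simp [Matrix.IsHermitian, ← Matrix.ext_iff]
  · simp only [dotProduct, Matrix.mulVec, Finset.mul_sum, star_trivial]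
    simp only [mul_assoc, mul_comm (c _) (M _ _)]

/-- The entrywise powers of a positive semidefinite matrix are positive semidefinite. -/
lemma Matrix.PosSemidef.map_pow {M : Matrix (Fin n) (Fin n) ℝ} (hM : M.PosSemidef) (k : ℕ) :
    (M.map (· ^ k)).PosSemidef := by
  induction k with
  | zero =>
    rw [Matrix.posSemidef_real_iff_sum]
    refine ⟨fun i j => by simp, fun c => ?_⟩
    simp only [Matrix.map_apply, pow_zero, mul_one, ← Finset.mul_sum, ← Finset.sum_mul]
    exact mul_self_nonneg _
  | succ k ih =>
    have h : M.map (· ^ (k + 1)) = (M.map (· ^ k)).hadamard M := by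
      ext i j
      simp [pow_succ]
    rw [h]
    exact ih.hadamard hM

/-- The entrywise exponential of a positive semidefinite matrix is positive semidefinite. -/
lemma Matrix.PosSemidef.map_exp {M : Matrix (Fin n) (Fin n) ℝ} (hM : M.PosSemidef) :
    (M.map Real.exp).PosSemidef := by
  rw [Matrix.posSemidef_real_iff_sum]
  refine ⟨fun i j => ?_, fun c => ?_⟩
  · simp [(Matrix.posSemidef_real_iff_sum.1 hM).1 i j]
  · have h : HasSum (fun k : ℕ => ∑ i, ∑ j, c i * c j * (M i j ^ k / k.factorial))
        (∑ i, ∑ j, c i * c j * M.map Real.exp i j) := by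
      refine hasSum_sum fun i _ => hasSum_sum fun j _ => HasSum.mul_left _ ?_
      simpa [Real.exp_eq_exp_ℝ] using NormedSpace.expSeries_div_hasSum_exp (M i j)
    refine h.nonneg fun k => ?_
    have h2 := (Matrix.posSemidef_real_iff_sum.1 (hM.map_pow k)).2 c
    have : ∑ i, ∑ j, c i * c j * (M i j ^ k / k.factorial) =
        (∑ i, ∑ j, c i * c j * M.map (· ^ k) i j) / k.factorial := by
      simp only [Finset.sum_div, Matrix.map_apply, mul_div_assoc]
    rw [this]
    positivity

end Matrices

/-! ### Real positive definite functions -/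

namespace IsRealPosDef

variable {G : Type*} [Group G] {φ : G → ℝ}

lemma symm (hφ : IsRealPosDef φ) (g : G) : φ g⁻¹ = φ g := by
  simpa using (Matrix.posSemidef_real_iff_sum.1 (hφ 2 ![1, g])).1 0 1

lemma sum_nonneg (hφ : IsRealPosDef φ) {n : ℕ} (g : Fin n → G) (c : Fin n → ℝ) :
    0 ≤ ∑ i, ∑ j, c i * c j * φ ((g i)⁻¹ * g j) :=
  (Matrix.posSemidef_real_iff_sum.1 (hφ n g)).2 c

lemma of_sum_nonneg (h₁ : ∀ g, φ g⁻¹ = φ g)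
    (h₂ : ∀ (n : ℕ) (g : Fin n → G) (c : Fin n → ℝ),
      0 ≤ ∑ i, ∑ j, c i * c j * φ ((g i)⁻¹ * g j)) : IsRealPosDef φ := fun n g =>
  Matrix.posSemidef_real_iff_sum.2 ⟨fun i j => by simp [← h₁ ((g i)⁻¹ * g j)], h₂ n g⟩

lemma finset_sum_nonneg (hφ : IsRealPosDef φ) (s : Finset G) (c : G → ℝ) :
    0 ≤ ∑ g ∈ s, ∑ h ∈ s, c g * c h * φ (g⁻¹ * h) := by
  have h := hφ.sum_nonneg (fun i => (s.equivFin.symm i : G)) fun i => c (s.equivFin.symm i)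
  rw [← Finset.sum_coe_sort]
  simp_rw [← Finset.sum_coe_sort s]
  rw [← s.equivFin.symm.sum_comp]
  simp_rw [← s.equivFin.symm.sum_comp (fun x : s => c _ * c x * φ (_⁻¹ * x))]
  exact h

lemma pow (hφ : IsRealPosDef φ) (k : ℕ) : IsRealPosDef fun g => φ g ^ k :=
  fun n g => (hφ n g).map_pow k

lemma comp (hφ : IsRealPosDef φ) {H : Type*} [Group H] (f : H →* G) :
    IsRealPosDef fun h => φ (f h) := fun n g => by
  have h := hφ n fun i => f (g i)
  simp_rw [← map_inv, ← map_mul] at h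
  exact h

open scoped ComplexConjugate in
lemma isPosDefFun (hφ : IsRealPosDef φ) : IsPosDefFun fun g => (φ g : ℂ) := by
  intro n g c
  have hsymm : ∀ i j, φ ((g j)⁻¹ * g i) = φ ((g i)⁻¹ * g j) := fun i j => by
    simpa only [mul_inv_rev, inv_inv] using hφ.symm ((g i)⁻¹ * g j)
  rw [Complex.nonneg_iff]
  constructor
  -- By symmetry of `φ` the cross terms cancel, leaving the real forms at `re c` and `im c`.
  · have h := add_nonneg (hφ.sum_nonneg g fun i => (c i).re) (hφ.sum_nonneg g fun i => (c i).im)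
    refine h.trans_eq ?_
    simp only [Complex.re_sum, ← Finset.sum_add_distrib]
    refine Finset.sum_congr rfl fun i _ => Finset.sum_congr rfl fun j _ => ?_
    simp
    ring
  · have h : (∑ i, ∑ j, conj (c i) * c j * (φ ((g i)⁻¹ * g j) : ℂ)).im =
        ∑ i, ∑ j, (c i).re * (c j).im * φ ((g i)⁻¹ * g j) -
          ∑ i, ∑ j, (c j).re * (c i).im * φ ((g i)⁻¹ * g j) := by
      simp only [Complex.im_sum, ← Finset.sum_sub_distrib]
      refine Finset.sum_congr rfl fun i _ => Finset.sum_congr rfl fun j _ => ?_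
      simp
      ring
    rw [h, eq_comm, sub_eq_zero, Finset.sum_comm]
    simp only [hsymm]

end IsRealPosDef

/-! ### Conditionally negative definite functions and Schoenberg's theorem -/

namespace IsCondNegDef

variable {G : Type*} [Group G] {ψ : G → ℝ}

lemma apply_one_le (hψ : IsCondNegDef ψ) (g : G) : ψ 1 ≤ ψ g := by
  have h := hψ.sum_nonpos 2 ![1, g] ![1, -1] (by simp)
  simp [Fin.sum_univ_two, hψ.symm] at h
  linarith

/-- **Schoenberg's theorem**, for `ψ` not necessarily vanishing at `1`. -/
lemma isRealPosDef_exp (hψ : IsCondNegDef ψ) {t : ℝ} (ht : 0 ≤ t) :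
    IsRealPosDef fun g => Real.exp (-(t * (ψ g - ψ 1))) := by
  refine IsRealPosDef.of_sum_nonneg (fun g => by simp [hψ.symm]) fun n g c => ?_
  have hM : (Matrix.of fun i j => t * (ψ (g i) + ψ (g j) - ψ ((g i)⁻¹ * g j) - ψ 1)).PosSemidef := by
    rw [Matrix.posSemidef_real_iff_sum]
    refine ⟨fun i j => ?_, fun c => ?_⟩
    · have := hψ.symm ((g i)⁻¹ * g j)
      simp only [mul_inv_rev, inv_inv] at this
      simp only [Matrix.of_apply, this]
      ring
    -- Adjoining the point 1 with weight `-∑ cᵢ` makes the total weight zero.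
    · have h := hψ.sum_nonpos (n + 1) (Fin.cons 1 g) (Fin.cons (-∑ i, c i) c)
        (by simp [Fin.sum_univ_succ])
      simp only [Fin.sum_univ_succ, Fin.cons_zero, Fin.cons_succ, inv_one, one_mul, mul_one,
        hψ.symm, Finset.sum_add_distrib] at h
      have e : ∑ i, ∑ j, c i * c j *
          Matrix.of (fun i j => t * (ψ (g i) + ψ (g j) - ψ ((g i)⁻¹ * g j) - ψ 1)) i j =
          t * (2 * (∑ i, c i) * (∑ i, c i * ψ (g i)) - (∑ i, c i) * (∑ i, c i) * ψ 1
            - ∑ i, ∑ j, c i * c j * ψ ((g i)⁻¹ * g j)) := by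
        have e1 : ∑ i, ∑ j, c i * c j * ψ (g i) = (∑ i, c i) * ∑ i, c i * ψ (g i) := by
          rw [Finset.sum_mul_sum, Finset.sum_comm]
          exact Finset.sum_congr rfl fun i _ => Finset.sum_congr rfl fun j _ => by ring
        have e2 : ∑ i, ∑ j, c i * c j * ψ (g j) = (∑ i, c i) * ∑ i, c i * ψ (g i) := by
          rw [Finset.sum_mul_sum]
          exact Finset.sum_congr rfl fun i _ => Finset.sum_congr rfl fun j _ => by ring
        have e3 : ∑ i, ∑ j, c i * c j * ψ 1 = (∑ i, c i) * (∑ i, c i) * ψ 1 := by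
          rw [Finset.sum_mul_sum, Finset.sum_mul]
          exact Finset.sum_congr rfl fun i _ => (Finset.sum_mul _ _ _).symm
        calc _ = t * (∑ i, ∑ j, c i * c j * ψ (g i) + ∑ i, ∑ j, c i * c j * ψ (g j)
              - ∑ i, ∑ j, c i * c j * ψ ((g i)⁻¹ * g j) - ∑ i, ∑ j, c i * c j * ψ 1) := by
              simp only [← Finset.sum_add_distrib, ← Finset.sum_sub_distrib, Finset.mul_sum]
              exact Finset.sum_congr rfl fun i _ => Finset.sum_congr rfl fun j _ => by
                simp only [Matrix.of_apply]; ring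
          _ = _ := by rw [e1, e2, e3]; ring
      rw [e]
      refine mul_nonneg ht ?_
      have e4 (S : ℝ) : ∑ i, -S * c i * ψ (g i) = -(S * ∑ i, c i * ψ (g i)) := by
        rw [Finset.mul_sum, ← Finset.sum_neg_distrib]
        exact Finset.sum_congr rfl fun i _ => by ring
      have e5 (S : ℝ) : ∑ i, c i * -S * ψ (g i) = -(S * ∑ i, c i * ψ (g i)) := by
        rw [← e4]
        exact Finset.sum_congr rfl fun i _ => by ring
      rw [e4, e5] at h
      linarith
  -- The target kernel is `exp` of the semidefinite one, rescaled on both sides by a positive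
  -- diagonal matrix, which the coefficients absorb.
  have h := (Matrix.posSemidef_real_iff_sum.1 hM.map_exp).2
    fun i => c i * Real.exp (-(t * (ψ (g i) - ψ 1)))
  convert h using 1
  refine Finset.sum_congr rfl fun i _ => Finset.sum_congr rfl fun j _ => ?_
  have : Real.exp (-(t * (ψ ((g i)⁻¹ * g j) - ψ 1))) = Real.exp (-(t * (ψ (g i) - ψ 1))) *
      Real.exp (-(t * (ψ (g j) - ψ 1))) *
      Real.exp (t * (ψ (g i) + ψ (g j) - ψ ((g i)⁻¹ * g j) - ψ 1)) := by
    rw [← Real.exp_add, ← Real.exp_add]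
    congr 1
    ring
  simp only [this, Matrix.map_apply, Matrix.of_apply]
  ring

end IsCondNegDef

/-! ### The real group algebra and the form of a positive definite function -/

open MonoidAlgebra in
/-- The involution of the real group algebra induced by inversion in the group. -/
noncomputable def MonoidAlgebra.involution (G : Type*) [Group G] :
    MonoidAlgebra ℝ G →ₗ[ℝ] MonoidAlgebra ℝ G :=
  mapDomainLinearMap ℝ ℝ fun g => g⁻¹

/-- The linear form on the real group algebra extending a function on the group. -/
noncomputable def MonoidAlgebra.linearExtension {G : Type*} [Group G] (φ : G → ℝ) :
    MonoidAlgebra ℝ G →ₗ[ℝ] ℝ :=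
  Finsupp.linearCombination ℝ φ ∘ₗ (coeffLinearEquiv ℝ).toLinearMap

namespace MonoidAlgebra

variable {G : Type*} [Group G]

@[simp]
lemma involution_single (g : G) (r : ℝ) : involution G (single g r) = single g⁻¹ r := by
  simp [involution]

@[simp]
lemma linearExtension_single (φ : G → ℝ) (g : G) (r : ℝ) :
    linearExtension φ (single g r) = r * φ g := by
  simp [linearExtension]

lemma involution_mul (x y : MonoidAlgebra ℝ G) :
    involution G (x * y) = involution G y * involution G x := by
  induction x using MonoidAlgebra.induction_linear with
  | zero => simp
  | add a b ha hb => simp [add_mul, mul_add, ha, hb]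
  | single g r =>
    induction y using MonoidAlgebra.induction_linear with
    | zero => simp
    | add a b ha hb => simp [add_mul, mul_add, ha, hb]
    | single h s => simp [single_mul_single, mul_comm]

lemma involution_map {H : Type*} [Group H] (f : G →* H) (x : MonoidAlgebra ℝ G) :
    involution H (mapDomainAlgHom ℝ ℝ f x) = mapDomainAlgHom ℝ ℝ f (involution G x) := by
  induction x using MonoidAlgebra.induction_linear with
  | zero => simp
  | add a b ha hb => simp only [map_add, ha, hb]
  | single g r => simp

lemma linearExtension_map {H : Type*} [Group H] (φ : H → ℝ) (f : G →* H) (x : MonoidAlgebra ℝ G) :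
    linearExtension φ (mapDomainAlgHom ℝ ℝ f x) = linearExtension (fun g => φ (f g)) x := by
  induction x using MonoidAlgebra.induction_linear with
  | zero => simp
  | add a b ha hb => simp only [map_add, ha, hb]
  | single g r => simp

/-- The form `(x, y) ↦ φ(x* y)` on the real group algebra. -/
noncomputable def form (φ : G → ℝ) : LinearMap.BilinForm ℝ (MonoidAlgebra ℝ G) :=
  LinearMap.mk₂ ℝ (fun x y => linearExtension φ (involution G x * y))
    (fun _ _ _ => by simp [add_mul]) (fun _ _ _ => by simp) (fun _ _ _ => by simp [mul_add])
    (fun _ _ _ => by simp)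

lemma form_apply (φ : G → ℝ) (x y : MonoidAlgebra ℝ G) :
    form φ x y = linearExtension φ (involution G x * y) := rfl

variable {φ : G → ℝ}

lemma form_comm (hφ : ∀ g, φ g⁻¹ = φ g) (x y : MonoidAlgebra ℝ G) : form φ x y = form φ y x := by
  induction x using MonoidAlgebra.induction_linear with
  | zero => simp
  | add a b ha hb => simp [ha, hb]
  | single g r =>
    induction y using MonoidAlgebra.induction_linear with
    | zero => simp
    | add a b ha hb => simp only [map_add, LinearMap.add_apply, ha, hb]
    | single h s =>
      have := hφ (g⁻¹ * h)
      simp only [mul_inv_rev, inv_inv] at this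
      simp [form_apply, single_mul_single, mul_comm r s, this]

lemma form_self_nonneg (hφ : IsRealPosDef φ) (x : MonoidAlgebra ℝ G) : 0 ≤ form φ x x := by
  have h := hφ.finset_sum_nonneg x.coeff.support x.coeff
  have hx : x = ∑ g ∈ x.coeff.support, single g (x.coeff g) := (sum_coeff_single x).symm
  convert h using 1
  conv_lhs => rw [hx]
  simp only [map_sum, LinearMap.sum_apply, form_apply, involution_single, single_mul_single,
    linearExtension_single]
  exact Finset.sum_comm

lemma form_le_sqrt_mul_sqrt (hφ : IsRealPosDef φ) (x y : MonoidAlgebra ℝ G) :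
    form φ x y ≤ √(form φ x x) * √(form φ y y) := by
  rw [← Real.sqrt_mul (form_self_nonneg hφ x)]
  exact Real.le_sqrt_of_sq_le ((form φ).apply_sq_le_of_symm (form_self_nonneg hφ)
    ⟨fun x y => form_comm hφ.symm x y⟩ x y)

end MonoidAlgebra

open MonoidAlgebra

/-! ### Square partitions and the affinity of translates -/

section Affinity

variable {A : Type*} [CommGroup A]

/-- A finite family `p` in the group algebra with `∑ pᵢ* pᵢ = 1`. -/
def IsSquarePartition {ι : Type} [Fintype ι] (p : ι → MonoidAlgebra ℝ A) : Prop :=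
  ∑ i, involution A (p i) * p i = 1

lemma IsSquarePartition.map {ι : Type} [Fintype ι] {p : ι → MonoidAlgebra ℝ A}
    (hp : IsSquarePartition p) {B : Type*} [CommGroup B] (f : A →* B) :
    IsSquarePartition fun i => mapDomainAlgHom ℝ ℝ f (p i) := by
  have h := congrArg (mapDomainAlgHom ℝ ℝ f) hp
  simp only [map_sum, map_mul, map_one, ← involution_map] at h
  exact h

lemma IsSquarePartition.sum_form {ι : Type} [Fintype ι] {p : ι → MonoidAlgebra ℝ A}
    (hp : IsSquarePartition p) (φ : A → ℝ) (x : MonoidAlgebra ℝ A) :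
    ∑ i, form φ (x * p i) (x * p i) = form φ x x := by
  have h : involution A x * x = ∑ i, involution A (x * p i) * (x * p i) := by
    have h2 : involution A x * x * ∑ i, involution A (p i) * p i = involution A x * x := by
      rw [show ∑ i, involution A (p i) * p i = 1 from hp, mul_one]
    rw [← h2, Finset.mul_sum]
    refine Finset.sum_congr rfl fun i _ => ?_
    rw [involution_mul]
    ring
  simp only [form_apply, h, map_sum]

lemma IsSquarePartition.mul {ι κ : Type} [Fintype ι] [Fintype κ] {p : ι → MonoidAlgebra ℝ A}
    {q : κ → MonoidAlgebra ℝ A} (hp : IsSquarePartition p) (hq : IsSquarePartition q) :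
    IsSquarePartition fun i : ι × κ => p i.1 * q i.2 := by
  have h := congrArg₂ (· * ·) hp hq
  simp only [mul_one, Finset.sum_mul_sum] at h
  rw [IsSquarePartition, ← h, Fintype.sum_prod_type]
  refine Finset.sum_congr rfl fun i _ => Finset.sum_congr rfl fun j _ => ?_
  rw [involution_mul]
  ring

lemma isSquarePartition_one : IsSquarePartition fun _ : Unit => (1 : MonoidAlgebra ℝ A) := by
  simp [IsSquarePartition, one_def]

/-- The two-element partition `((1 + a) / 2, (1 - a) / 2)`. -/
lemma isSquarePartition_pair (a : A) :
    IsSquarePartition fun i : Bool => ((2⁻¹ : ℝ) • (1 + single a (if i then 1 else -1)) :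
      MonoidAlgebra ℝ A) := by
  have h₁ : (single a⁻¹ 1 * single a 1 : MonoidAlgebra ℝ A) = 1 := by
    rw [single_mul_single, inv_mul_cancel, one_mul, one_def]
  have h₂ : involution A 1 = 1 := by simp [one_def]
  have h₃ : ∀ b : A, (single b (-1) : MonoidAlgebra ℝ A) = -single b 1 := fun b => by simp
  have h₄ : 2 * algebraMap ℝ (MonoidAlgebra ℝ A) 2⁻¹ = 1 := by
    rw [← map_ofNat (algebraMap ℝ (MonoidAlgebra ℝ A)) 2, ← map_mul,
      mul_inv_cancel₀ two_ne_zero, map_one]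
  simp only [IsSquarePartition, Fintype.sum_bool, map_add, map_smul, involution_single, h₂,
    if_true, Bool.false_eq_true, if_false, h₃]
  simp only [Algebra.smul_def]
  linear_combination (2 * algebraMap ℝ (MonoidAlgebra ℝ A) 2⁻¹ ^ 2) * h₁ +
    (2 * algebraMap ℝ (MonoidAlgebra ℝ A) 2⁻¹ + 1) * h₄

variable {H : Type*} [Group H] (α : H →* MulAut A) (φ : A → ℝ)

/-- The weight of `x* x` under the translate of `φ` by `h`. -/
noncomputable def translateForm (h : H) (x : MonoidAlgebra ℝ A) : ℝ :=
  form φ (mapDomainAlgHom ℝ ℝ (α h : A →* A) x) (mapDomainAlgHom ℝ ℝ (α h : A →* A) x)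

variable {φ}

lemma translateForm_nonneg (hφ : IsRealPosDef φ) (h : H) (x : MonoidAlgebra ℝ A) :
    0 ≤ translateForm α φ h x := form_self_nonneg hφ _

lemma translateForm_mul (g h : H) (x : MonoidAlgebra ℝ A) :
    translateForm α φ (g * h) x =
      translateForm α φ g (mapDomainAlgHom ℝ ℝ (α h : A →* A) x) := by
  have : mapDomainAlgHom ℝ ℝ (α (g * h) : A →* A) x =
      mapDomainAlgHom ℝ ℝ (α g : A →* A) (mapDomainAlgHom ℝ ℝ (α h : A →* A) x) := by
    rw [← AlgHom.comp_apply, ← mapDomainAlgHom_comp]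
    congr 2
    ext
    simp
  simp only [translateForm, this]

variable {α} in
lemma IsSquarePartition.sum_translateForm {ι : Type} [Fintype ι] {p : ι → MonoidAlgebra ℝ A}
    (hp : IsSquarePartition p) (h : H) (x : MonoidAlgebra ℝ A) :
    ∑ i, translateForm α φ h (x * p i) = translateForm α φ h x := by
  simp only [translateForm, map_mul]
  exact (hp.map _).sum_form φ _

/-- The functions `(g, h) ↦ ∑ᵢ √(φ_g(pᵢ* pᵢ)) √(φ_h(pᵢ* pᵢ))` for `p` a partition. -/
def partitionKernels (φ : A → ℝ) : Set (H → H → ℝ) :=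
  {F | ∃ (ι : Type) (_ : Fintype ι) (p : ι → MonoidAlgebra ℝ A), IsSquarePartition p ∧
    F = fun g h => ∑ i, √(translateForm α φ g (p i)) * √(translateForm α φ h (p i))}

lemma partitionKernels_nonempty : (partitionKernels α φ).Nonempty :=
  ⟨_, Unit, inferInstance, _, isSquarePartition_one, rfl⟩

/-- Refining a partition lowers its kernel: Cauchy–Schwarz inside each piece of `p`. Products then
serve as common refinements. -/
lemma sum_partition_mul_le (hφ : IsRealPosDef φ) {ι κ : Type} [Fintype ι] [Fintype κ]
    (p : ι → MonoidAlgebra ℝ A) {q : κ → MonoidAlgebra ℝ A} (hq : IsSquarePartition q) (g h : H) :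
    ∑ i : ι × κ, √(translateForm α φ g (p i.1 * q i.2)) * √(translateForm α φ h (p i.1 * q i.2)) ≤
      ∑ i, √(translateForm α φ g (p i)) * √(translateForm α φ h (p i)) := by
  rw [Fintype.sum_prod_type]
  refine Finset.sum_le_sum fun i _ => ?_
  rw [← hq.sum_translateForm g (p i), ← hq.sum_translateForm h (p i)]
  exact Real.sum_sqrt_mul_sqrt_le _ (fun _ => translateForm_nonneg α hφ _ _)
    fun _ => translateForm_nonneg α hφ _ _

lemma directedOn_partitionKernels (hφ : IsRealPosDef φ) :
    DirectedOn (· ≥ ·) (partitionKernels α φ) := by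
  rintro _ ⟨ι, _, p, hp, rfl⟩ _ ⟨κ, _, q, hq, rfl⟩
  refine ⟨_, ⟨ι × κ, inferInstance, _, hp.mul hq, rfl⟩, fun g h => ?_, fun g h => ?_⟩
  · exact sum_partition_mul_le α hφ p hq g h
  · refine le_trans (le_of_eq ?_) (sum_partition_mul_le α hφ q hp g h)
    dsimp only
    rw [← (Equiv.prodComm κ ι).sum_comp]
    simp [mul_comm]

/-- The affinity of the translates of `φ` by `g` and `h`. -/
noncomputable def affinity (φ : A → ℝ) (g h : H) : ℝ :=
  ⨅ F : partitionKernels α φ, F.1 g h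

variable {α}

lemma nonneg_of_mem_partitionKernels {F : H → H → ℝ}
    (hF : F ∈ partitionKernels α φ) (g h : H) : 0 ≤ F g h := by
  obtain ⟨ι, _, p, hp, rfl⟩ := hF
  exact Finset.sum_nonneg fun _ _ => by positivity

lemma self_of_mem_partitionKernels (hφ : IsRealPosDef φ) {F : H → H → ℝ}
    (hF : F ∈ partitionKernels α φ) (g : H) : F g g = φ 1 := by
  obtain ⟨ι, _, p, hp, rfl⟩ := hF
  have h := hp.sum_translateForm (α := α) (φ := φ) g 1
  simp only [one_mul] at h
  simp only [Real.mul_self_sqrt (translateForm_nonneg α hφ _ _), h]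
  simp [translateForm, form_apply, one_def]

lemma comm_of_mem_partitionKernels {F : H → H → ℝ}
    (hF : F ∈ partitionKernels α φ) (g h : H) : F g h = F h g := by
  obtain ⟨ι, _, p, hp, rfl⟩ := hF
  exact Finset.sum_congr rfl fun _ _ => mul_comm _ _

/-- Each kernel is a Gram kernel, of the vectors `(√φ_g(pₖ* pₖ))ₖ`. -/
lemma sum_nonneg_of_mem_partitionKernels {F : H → H → ℝ}
    (hF : F ∈ partitionKernels α φ) {n : ℕ} (g : Fin n → H) (c : Fin n → ℝ) :
    0 ≤ ∑ i, ∑ j, c i * c j * F (g i) (g j) := by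
  obtain ⟨ι, _, p, hp, rfl⟩ := hF
  have : ∑ i, ∑ j, c i * c j *
      ∑ k, √(translateForm α φ (g i) (p k)) * √(translateForm α φ (g j) (p k)) =
      ∑ k, (∑ i, c i * √(translateForm α φ (g i) (p k))) ^ 2 := by
    simp only [sq, Finset.sum_mul_sum]
    simp only [Finset.mul_sum]
    conv_rhs => rw [Finset.sum_comm]
    refine Finset.sum_congr rfl fun i _ => ?_
    rw [Finset.sum_comm]
    exact Finset.sum_congr rfl fun _ _ => Finset.sum_congr rfl fun _ _ => by ring
  rw [this]
  positivity

lemma affinity_le {F : H → H → ℝ} (hF : F ∈ partitionKernels α φ) (g h : H) :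
    affinity α φ g h ≤ F g h :=
  ciInf_le (f := fun F : partitionKernels α φ => F.1 g h)
    ⟨0, by rintro _ ⟨F, rfl⟩; exact nonneg_of_mem_partitionKernels F.2 g h⟩ ⟨F, hF⟩

lemma le_affinity {r : ℝ} {g h : H} (hr : ∀ F ∈ partitionKernels α φ, r ≤ F g h) :
    r ≤ affinity α φ g h :=
  have := (partitionKernels_nonempty α (φ := φ)).to_subtype
  le_ciInf fun F => hr F.1 F.2

lemma affinity_self (hφ : IsRealPosDef φ) (g : H) : affinity α φ g g = φ 1 := by
  have := (partitionKernels_nonempty α (φ := φ)).to_subtype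
  simp only [affinity, self_of_mem_partitionKernels hφ (Subtype.prop _), ciInf_const]

lemma affinity_comm (g h : H) : affinity α φ g h = affinity α φ h g := by
  simp only [affinity, comm_of_mem_partitionKernels (Subtype.prop _) g h]

lemma affinity_nonneg (g h : H) : 0 ≤ affinity α φ g h :=
  le_affinity fun _ hF => nonneg_of_mem_partitionKernels hF g h

/-- Acting by `k` carries partitions to partitions. -/
lemma affinity_le_mul_right (g h k : H) : affinity α φ g h ≤ affinity α φ (g * k) (h * k) := by
  refine le_affinity fun F hF => ?_
  obtain ⟨ι, _, p, hp, rfl⟩ := hF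
  simp only [translateForm_mul]
  exact affinity_le ⟨ι, inferInstance, _, hp.map (α k : A →* A), rfl⟩ g h

lemma affinity_mul_right (g h k : H) : affinity α φ (g * k) (h * k) = affinity α φ g h :=
  le_antisymm (by simpa using affinity_le_mul_right (α := α) (φ := φ) (g * k) (h * k) k⁻¹)
    (affinity_le_mul_right g h k)

/-- Directedness turns the pointwise infima into limits along one common filter, so positivity of
the kernels passes to the affinity. -/
lemma affinity_sum_nonneg (hφ : IsRealPosDef φ) {n : ℕ} (g : Fin n → H) (c : Fin n → ℝ) :
    0 ≤ ∑ i, ∑ j, c i * c j * affinity α φ (g i) (g j) := by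
  have := (partitionKernels_nonempty α (φ := φ)).to_subtype
  have : IsCodirectedOrder (partitionKernels α φ) :=
    ⟨directedOn_iff_directed.1 (directedOn_partitionKernels α hφ)⟩
  have h : ∀ g h : H, Filter.Tendsto (fun F : partitionKernels α φ => F.1 g h) Filter.atBot
      (nhds (affinity α φ g h)) := fun g h =>
    tendsto_atBot_ciInf (fun F F' hF => hF g h)
      ⟨0, by rintro _ ⟨F, rfl⟩; exact nonneg_of_mem_partitionKernels F.2 g h⟩
  refine ge_of_tendsto' (tendsto_finsetSum _ fun i _ => tendsto_finsetSum _ fun j _ =>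
    (h (g i) (g j)).const_mul (c i * c j)) fun F => sum_nonneg_of_mem_partitionKernels F.2 g c

/-- The affinity of `φ` and its translate, as a function on the acting group, is positive
definite. -/
lemma isRealPosDef_affinity (hφ : IsRealPosDef φ) :
    IsRealPosDef fun h : H => affinity α φ 1 h⁻¹ := by
  refine IsRealPosDef.of_sum_nonneg (fun g => ?_) fun n g c => ?_
  · rw [← affinity_mul_right 1 g⁻¹ g, affinity_comm]
    simp
  -- The kernel is right invariant; inverses convert this to the left invariance in the definition.
  · have h := affinity_sum_nonneg (α := α) hφ (fun i => (g i)⁻¹) c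
    have e : ∀ i j, affinity α φ 1 ((g i)⁻¹ * g j)⁻¹ = affinity α φ (g i)⁻¹ (g j)⁻¹ := fun i j => by
      rw [← affinity_mul_right 1 _ (g i)⁻¹]
      simp
    simpa only [e] using h

end Affinity


/-! ### Comparison with the function on the semidirect product -/

section Semidirect

variable {A K₀ K : Type*} [CommGroup A] [Group K₀] [Group K] {α : K₀ →* MulAut A} {π : K →* K₀}

lemma form_map_self {G H : Type*} [Group G] [Group H] (φ : H → ℝ) (f : G →* H)
    (x : MonoidAlgebra ℝ G) :
    form φ (mapDomainAlgHom ℝ ℝ f x) (mapDomainAlgHom ℝ ℝ f x) = form (fun g => φ (f g)) x x := by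
  rw [form_apply, involution_map, ← map_mul, linearExtension_map, form_apply]

lemma form_single_mul {G : Type*} [Group G] (φ : G → ℝ) (g : G) (x y : MonoidAlgebra ℝ G) :
    form φ (single g 1 * x) (single g 1 * y) = form φ x y := by
  rw [form_apply, involution_mul, involution_single, mul_assoc, ← mul_assoc (single g⁻¹ 1),
    single_mul_single, inv_mul_cancel, one_mul, ← one_def, one_mul, form_apply]

lemma map_inl_action (k : K) (x : MonoidAlgebra ℝ A) :
    mapDomainAlgHom ℝ ℝ (SemidirectProduct.inl : A →* A ⋊[α.comp π] K)
        (mapDomainAlgHom ℝ ℝ (α (π k) : A →* A) x) =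
      single (SemidirectProduct.inr k) 1 * (mapDomainAlgHom ℝ ℝ SemidirectProduct.inl x *
        single (SemidirectProduct.inr k⁻¹) 1) := by
  induction x using MonoidAlgebra.induction_linear with
  | zero => simp
  | add a b ha hb => simp only [map_add, ha, hb, add_mul, mul_add]
  | single g r =>
    have h := SemidirectProduct.inl_aut (φ := α.comp π) k g
    simp only [MonoidHom.comp_apply] at h
    simp [single_mul_single, h, mul_assoc]

variable {φ : A ⋊[α.comp π] K → ℝ}

/-- Since `∑ pᵢ* pᵢ = 1`, `φ(k⁻¹) = ∑ φ(pᵢ* pᵢ k⁻¹)`. Cauchy–Schwarz bounds each term, and `pᵢ k⁻¹`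
has the same norm as `k pᵢ k⁻¹`, the translate of `pᵢ`. -/
lemma le_affinity_of_inr (hφ : IsRealPosDef φ) (k : K) :
    φ (SemidirectProduct.inr k⁻¹) ≤
      affinity α (fun a => φ (SemidirectProduct.inl a)) 1 (π k) := by
  refine le_affinity fun F hF => ?_
  obtain ⟨ι, _, p, hp, rfl⟩ := hF
  set j := mapDomainAlgHom ℝ ℝ (SemidirectProduct.inl : A →* A ⋊[α.comp π] K)
  have h₁ : ∀ x, translateForm α (fun a => φ (SemidirectProduct.inl a)) 1 x =
      form φ (j x) (j x) := fun x => by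
    rw [translateForm, ← form_map_self φ SemidirectProduct.inl]
    have h := map_inl_action (α := α) (π := π) 1 x
    simp only [map_one, inv_one, ← one_def, one_mul, mul_one] at h
    rw [map_one, h]
  have h₂ : ∀ x, translateForm α (fun a => φ (SemidirectProduct.inl a)) (π k) x =
      form φ (j x * single (SemidirectProduct.inr k⁻¹) 1)
        (j x * single (SemidirectProduct.inr k⁻¹) 1) := fun x => by
    rw [translateForm, ← form_map_self φ SemidirectProduct.inl, map_inl_action, form_single_mul]
  have h₃ : φ (SemidirectProduct.inr k⁻¹) =
      ∑ i, form φ (j (p i)) (j (p i) * single (SemidirectProduct.inr k⁻¹) 1) := by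
    simp only [form_apply, ← mul_assoc, ← map_sum, ← Finset.sum_mul]
    have : ∑ i, involution _ (j (p i)) * j (p i) = 1 := by
      simp only [j, involution_map, ← map_mul, ← map_sum]
      rw [show ∑ i, involution A (p i) * p i = 1 from hp, map_one]
    rw [this]
    simp
  rw [h₃]
  refine Finset.sum_le_sum fun i _ => ?_
  simp only [h₁, h₂]
  exact form_le_sqrt_mul_sqrt hφ _ _

end Semidirect

/-! ### Two-piece partitions and the numerical estimate -/

section PairEstimate

variable {A H : Type*} [CommGroup A] [Group H] {α : H →* MulAut A} {φ : A → ℝ}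

lemma translateForm_pair (hφ : IsRealPosDef φ) (h1 : φ 1 = 1) (h : H) (a : A) (r : ℝ)
    (hr : r ^ 2 = 1) :
    translateForm α φ h ((2⁻¹ : ℝ) • (1 + single a r)) = (1 + r * φ (α h a)) / 2 := by
  have hs := hφ.symm (α h a)
  simp only [translateForm, one_def, map_smul, map_add, mapDomainAlgHom_apply, mapDomain_single,
    MonoidHom.coe_coe, map_one, form_apply, involution_single, LinearMap.smul_apply,
    LinearMap.add_apply, single_mul_single, linearExtension_single,
    smul_eq_mul, inv_one, one_mul, mul_one, inv_mul_cancel, hs, h1]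
  linear_combination hr / 4

lemma affinity_le_pair (hφ : IsRealPosDef φ) (h1 : φ 1 = 1) (a : A) (g h : H) :
    affinity α φ g h ≤ √((1 + φ (α g a)) / 2) * √((1 + φ (α h a)) / 2) +
      √((1 - φ (α g a)) / 2) * √((1 - φ (α h a)) / 2) := by
  refine (affinity_le ⟨Bool, inferInstance, _, isSquarePartition_pair a, rfl⟩ g h).trans_eq ?_
  simp only [Fintype.sum_bool, if_true, Bool.false_eq_true, if_false]
  simp only [translateForm_pair hφ h1 _ a 1 (by norm_num),
    translateForm_pair hφ h1 _ a (-1) (by norm_num), one_mul, neg_mul, ← sub_eq_add_neg]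

lemma IsRealPosDef.abs_le (hφ : IsRealPosDef φ) (h1 : φ 1 = 1) (a : A) : |φ a| ≤ 1 := by
  have h := fun r hr => (translateForm_nonneg (1 : Unit →* MulAut A) hφ 1 _).trans_eq
    (translateForm_pair (α := 1) hφ h1 () a r hr)
  have h₁ := h 1 (by norm_num)
  have h₂ := h (-1) (by norm_num)
  simp at h₁ h₂
  rw [_root_.abs_le]
  constructor <;> linarith

lemma lower_bound_of_fidelity {x y : ℝ} (hx : 9 / 10 ≤ x) (hx1 : x ≤ 1) (hy : |y| ≤ 1)
    (h : 49 / 50 ≤ √((1 + x) / 2) * √((1 + y) / 2) + √((1 - x) / 2) * √((1 - y) / 2)) :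
    1 / 8 ≤ y := by
  rw [abs_le] at hy
  have h₁ := Real.sq_sqrt (show 0 ≤ (1 + x) / 2 by linarith)
  have h₂ := Real.sq_sqrt (show 0 ≤ (1 + y) / 2 by linarith)
  have h₃ := Real.sq_sqrt (show 0 ≤ (1 - x) / 2 by linarith)
  have h₄ := Real.sq_sqrt (show 0 ≤ (1 - y) / 2 by linarith)
  have h₅ : 19 / 20 ≤ √((1 + x) / 2) := Real.le_sqrt_of_sq_le (by linarith)
  have h₆ := Real.sqrt_nonneg ((1 + y) / 2)
  set s := √((1 + x) / 2)
  set t := √((1 + y) / 2)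
  set u := √((1 - x) / 2)
  set v := √((1 - y) / 2)
  -- `(s, u)` and `(t, v)` are unit vectors with inner product at least `49 / 50`, so their squared
  -- distance is at most `1 / 25`. Hence `t ≥ 19 / 20 - 1 / 5 = 3 / 4` and `y = 2 t² - 1 ≥ 1 / 8`.
  have h₇ : (s - t) ^ 2 ≤ (1 / 5) ^ 2 := by nlinarith [sq_nonneg (u - v)]
  have h₈ := (abs_le.1 (abs_le_of_sq_le_sq h₇ (by norm_num))).2
  nlinarith

end PairEstimate

/-! ### The orbit bound and the main theorem -/

/-- The bound on an orbit, given an upper bound for `ψ` on the relevant generators. -/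
lemma IsCondNegDef.orbit_le {A K₀ K : Type*} [CommGroup A] [Group K₀] [Group K]
    {α : K₀ →* MulAut A} {π : K →* K₀} {U : Set K} {ε δ s : ℝ} {n : ℕ}
    (hn : (49 / 50 : ℝ) ^ n < ε) (hs : 0 < s) (hs₁ : s ≤ 1 / 10) (hs₂ : n * s ≤ δ)
    (hU : ∀ φ : K₀ → ℂ, IsPosDefFun φ → φ 1 = 1 →
      (∀ u ∈ π '' U, 1 - δ ≤ ‖φ u‖) → ∀ k : K₀, ε ≤ ‖φ k‖)
    {ψ : A ⋊[α.comp π] K → ℝ} (hψ : IsCondNegDef ψ) {a : A} {M : ℝ} (hM : 0 < M)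
    (ha : ψ (SemidirectProduct.inl a) ≤ M) (hUM : ∀ u ∈ U, ψ (SemidirectProduct.inr u) ≤ M)
    (k : K) :
    ψ (SemidirectProduct.inl (α.comp π k a)) ≤ (7 / s + 1) * M := by
  have hψ1 : 0 ≤ ψ 1 := hψ.nonneg 1
  set φ : A ⋊[α.comp π] K → ℝ := fun g => Real.exp (-(s / M * (ψ g - ψ 1))) with hφ_def
  have hφ : IsRealPosDef φ := hψ.isRealPosDef_exp (by positivity)
  have hφ1 : φ 1 = 1 := by simp [hφ_def]
  have hφM : ∀ g, ψ g ≤ M → Real.exp (-s) ≤ φ g := fun g hg => by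
    refine Real.exp_le_exp.2 (neg_le_neg ?_)
    calc s / M * (ψ g - ψ 1) ≤ s / M * M := by gcongr; linarith
      _ = s := by field_simp
  set φA : A → ℝ := fun a => φ (SemidirectProduct.inl a) with hφA_def
  have hφA : IsRealPosDef φA := hφ.comp SemidirectProduct.inl
  have hφA1 : φA 1 = 1 := by simp [hφA_def, hφ1]
  have key := hU _ ((isRealPosDef_affinity (α := α) hφA).pow n).isPosDefFun
    (by simp [affinity_self hφA, hφA1]) (by
      rintro _ ⟨u, hu, rfl⟩
      have h₁ := (hφM _ (hUM u hu)).trans (by simpa using le_affinity_of_inr hφ u⁻¹)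
      -- The power `n` costs only a factor in the exponent: `exp (-n s) ≥ 1 - n s ≥ 1 - δ`.
      have h₂ : 1 - δ ≤ Real.exp (-s) ^ n := by
        rw [← Real.exp_nat_mul]
        have := Real.add_one_le_exp (n * -s)
        linarith
      rw [Complex.norm_of_nonneg (pow_nonneg (affinity_nonneg _ _) _)]
      exact h₂.trans (pow_le_pow_left₀ (Real.exp_pos _).le h₁ n)) (π k)⁻¹
  rw [Complex.norm_of_nonneg (pow_nonneg (affinity_nonneg _ _) _), inv_inv] at key
  -- Taking `n`-th roots of `(49 / 50) ^ n < ε ≤ affinity ^ n`.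
  have haff : 49 / 50 ≤ affinity α φA 1 (π k) :=
    (lt_of_pow_lt_pow_left₀ n (affinity_nonneg _ _) (hn.trans_le key)).le
  have hfid := haff.trans (affinity_le_pair hφA hφA1 a 1 (π k))
  rw [map_one, MulAut.one_apply] at hfid
  have hlow : 1 / 8 ≤ φA (α (π k) a) := by
    refine lower_bound_of_fidelity ?_ (abs_le.1 (hφA.abs_le hφA1 a)).2 (hφA.abs_le hφA1 _) hfid
    have := Real.add_one_le_exp (-s)
    exact le_trans (by linarith) (hφM _ ha)
  set b := ψ (SemidirectProduct.inl (α.comp π k a)) with hb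
  have hlow' : 1 / 8 ≤ Real.exp (-(s / M * (b - ψ 1))) := hlow
  have hexp : Real.exp (s / M * (b - ψ 1)) ≤ 8 := by
    rw [Real.exp_neg] at hlow'
    have := inv_anti₀ (by norm_num) hlow'
    simpa using this
  -- `x + 1 ≤ exp x ≤ 8` replaces a logarithm; this is the 7 in the constant.
  have hle : s / M * (b - ψ 1) ≤ 7 := by linarith [Real.add_one_le_exp (s / M * (b - ψ 1))]
  have h1M : ψ 1 ≤ M := (hψ.apply_one_le _).trans ha
  have : b - ψ 1 ≤ 7 / s * M := by
    rw [div_mul_eq_mul_div, le_div_iff₀ hs]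
    rw [div_mul_eq_mul_div, div_le_iff₀ hM] at hle
    linarith
  linarith

theorem proposition4p3 (ε δ : ℝ) (hε : 0 < ε) (hδ : 0 < δ) :
    ∃ C : ℝ, 0 < C ∧
      ∀ (A : Type*) [CommGroup A] (K₀ : Type*) [Group K₀] (α : K₀ →* MulAut A)
        (K : Type*) [Group K] (π : K →* K₀), Function.Surjective π →
      ∀ U : Set K, Subgroup.closure U = ⊤ →
      (∀ φ : K₀ → ℂ, IsPosDefFun φ → φ 1 = 1 →
        (∀ u ∈ π '' U, 1 - δ ≤ ‖φ u‖) → ∀ k : K₀, ε ≤ ‖φ k‖) →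
      ∀ (a : A) (V : Set (A ⋊[α.comp π] K)), Subgroup.closure V = ⊤ →
        SemidirectProduct.inl a ∈ V → SemidirectProduct.inr '' U ⊆ V →
      ∀ ψ : A ⋊[α.comp π] K → ℝ, IsCondNegDef ψ →
        (⨆ y ∈ orbitInSemidirect (α.comp π) a, (ψ y : EReal)) ≤
          (C : EReal) * ⨆ v ∈ V, (ψ v : EReal) := by
  obtain ⟨n, hn⟩ := exists_pow_lt_of_lt_one hε (show (49 / 50 : ℝ) < 1 by norm_num)
  obtain ⟨s, hs, hs₁, hs₂⟩ : ∃ s : ℝ, 0 < s ∧ s ≤ 1 / 10 ∧ n * s ≤ δ := by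
    refine ⟨min (1 / 10) (δ / (n + 1)), by positivity, min_le_left _ _, ?_⟩
    calc n * min (1 / 10) (δ / (n + 1)) ≤ (n + 1) * (δ / (n + 1)) := by
          gcongr
          · linarith
          · exact min_le_right _ _
      _ = δ := by field_simp
  have hC : 0 < 7 / s + 1 := by positivity
  refine ⟨7 / s + 1, hC, ?_⟩
  intro A _ K₀ _ α K _ π _ U _ hU a V _ haV hUV ψ hψ
  refine iSup₂_le ?_
  rintro _ ⟨k, rfl⟩
  have hV : ∀ v ∈ V, (ψ v : EReal) ≤ ⨆ v ∈ V, (ψ v : EReal) := fun v hv =>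
    le_iSup₂ (f := fun v (_ : v ∈ V) => (ψ v : EReal)) v hv
  generalize (⨆ v ∈ V, (ψ v : EReal)) = S at hV
  induction S with
  | bot => exact absurd (hV _ haV) (by simp)
  | top =>
    rw [EReal.coe_mul_top_of_pos hC]
    exact le_top
  | coe m =>
    simp only [EReal.coe_le_coe_iff] at hV
    rw [← EReal.coe_mul, EReal.coe_le_coe_iff]
    have hm : 0 ≤ m := (hψ.nonneg _).trans (hV _ haV)
    rw [← div_le_iff₀' hC]
    -- The supremum `m` may be 0, while `orbit_le` divides by `M`; hence the passage to every `M >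
    -- m`.
    refine le_of_forall_gt_imp_ge_of_dense fun M hM => ?_
    rw [div_le_iff₀' hC]
    exact hψ.orbit_le hn hs hs₁ hs₂ hU (hm.trans_lt hM) ((hV _ haV).trans hM.le)
      (fun u hu => (hV _ (hUV ⟨u, hu, rfl⟩)).trans hM.le) k
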